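/- Let $\mathcal A$ be an Archimedean uniformly complete $f$-algebra: a real vector lattice with an associative bilinear multiplication (not assumed commutative or unital) such that $ab\ge 0$ for $a,b\ge 0$, and $a\wedge b=0$, $c\ge 0$ imply $(ac)\wedge b=(ca)\wedge b=0$; Archimedean means that $0\le nx\le y$ for all $n\in\mathbb N$ implies $x=0$, and uniformly complete means that for each $e\ge 0$ every $e$-uniform Cauchy sequence has an $e$-uniform limit. Let $p\ge 2$ be an integer. In a vector lattice $V$, an element $z\ge 0$ is called a majorant of $\varphi\in V$ if for every $x\in V$ there is a real $c>0$ with $|x|\wedge n|\varphi|\le c\,z$ for all $n\in\mathbb N$; and $\varphi$ is called finite in $V$ if it has a majorant in $V$. The set $\Pi_p(\mathcal A)=\{g_1\cdots g_p : g_1,\dots,g_p\in\mathcal A\}$ is a subalgebra and a sublattice of $\mathcal A$, hence a vector lattice under the inherited operations and order, and the following holds. (1) For all $g,u\in\mathcal A$: if $u$ is a majorant of $g$ in $\mathcal A$, then $u^p$ is a majorant of $g^p$ in $\Pi_p(\mathcal A)$; in particular $g^p$ is finite in $\Pi_p(\mathcal A)$ whenever $g$ is finite in $\mathcal A$. (2)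 Suppose in addition that $\mathcal A$ is semiprime, i.e. $0$ is its only nilpotent element. Then for all $g\in\mathcal A$ and all $u\in\mathcal A$ with $u\ge 0$, the element $u$ is a majorant of $g$ in $\mathcal A$ if and only if $u^p$ is a majorant of $g^p$ in $\Pi_p(\mathcal A)$. Moreover, $g$ is finite in $\mathcal A$ if and only if $g^p$ is finite in $\Pi_p(\mathcal A)$. -/

import Mathlib

section VectorLattices

variable (V : Type*) [AddCommGroup V] [Lattice V] [Module ℝ V]

/-- A vector lattice is Archimedean if `0 ≤ x`, `0 ≤ y` and `n x ≤ y` for all `n` force `x = 0`.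
(The class `Archimedean` of Mathlib is a different notion outside linear orders.) -/
def IsArchimedeanLattice : Prop :=
  ∀ x y : V, 0 ≤ x → 0 ≤ y → (∀ n : ℕ, n • x ≤ y) → x = 0

/-- A vector lattice is uniformly complete if for every `e ≥ 0` each `e`-uniform Cauchy sequence
has an `e`-uniform limit. -/
def IsUniformlyComplete : Prop :=
  ∀ e : V, 0 ≤ e → ∀ s : ℕ → V,
    (∀ ε : ℝ, 0 < ε → ∃ N : ℕ, ∀ m n : ℕ, N ≤ m → N ≤ n → |s m - s n| ≤ ε • e) →
    ∃ x : V, ∀ ε : ℝ, 0 < ε → ∃ N : ℕ, ∀ n : ℕ, N ≤ n → |s n - x| ≤ ε • e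

variable {V}

/-- `z` is a majorant of `φ` in the vector lattice `V`. -/
def IsMajorant (φ z : V) : Prop :=
  0 ≤ z ∧ ∀ x : V, ∃ c : ℝ, 0 < c ∧ ∀ n : ℕ, |x| ⊓ (n • |φ|) ≤ c • z

/-- `φ` is a finite element of the vector lattice `V`. -/
def IsFiniteElement (φ : V) : Prop :=
  ∃ z : V, IsMajorant φ z

end VectorLattices

section Algebras

/-- The conditions that make a vector lattice with an associative, bilinear multiplication
(not assumed commutative or unital) an `f`-algebra. -/
class IsFAlgebra (A : Type*) [NonUnitalRing A] [Lattice A] : Prop where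
  mul_nonneg' : ∀ a b : A, 0 ≤ a → 0 ≤ b → 0 ≤ a * b
  mul_right_inf : ∀ a b c : A, a ⊓ b = 0 → 0 ≤ c → (a * c) ⊓ b = 0
  mul_left_inf : ∀ a b c : A, a ⊓ b = 0 → 0 ≤ c → (c * a) ⊓ b = 0

variable {A : Type*} [NonUnitalRing A]

/-- The product `g₁ ⋯ gₚ` of `p ≥ 1` elements; the value at `p = 0` has no meaning, as there need
not be a unit. -/
def finProd : (p : ℕ) → (Fin p → A) → A
  | 0, _ => 0
  | 1, g => g 0
  | n + 2, g => finProd (n + 1) (fun i => g i.castSucc) * g (Fin.last (n + 1))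

/-- The power `aᵖ` for `p ≥ 1`. -/
def finPow (p : ℕ) (a : A) : A := finProd p (fun _ => a)

variable (A) in
/-- `A` has no nilpotent element other than zero. -/
def IsSemiprimeAlgebra : Prop :=
  ∀ a : A, (∃ n : ℕ, 1 ≤ n ∧ finPow n a = 0) → a = 0

variable (A) in
/-- The set `Π_p(A)` of all `p`-fold products. -/
def productSet (p : ℕ) : Set A := {x | ∃ g : Fin p → A, x = finProd p g}

theorem finPow_mem_productSet (p : ℕ) (a : A) : finPow p a ∈ productSet A p :=
  ⟨fun _ => a, rfl⟩

end Algebras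

/-- A subalgebra (linear subspace closed under multiplication) that is also a sublattice. -/
structure LatticeSubalgebra (A : Type*) [NonUnitalRing A] [Lattice A] [Module ℝ A] extends
    NonUnitalSubalgebra ℝ A where
  sup_mem' : ∀ {a b : A}, a ∈ carrier → b ∈ carrier → a ⊔ b ∈ carrier
  inf_mem' : ∀ {a b : A}, a ∈ carrier → b ∈ carrier → a ⊓ b ∈ carrier

namespace LatticeSubalgebra

variable {A : Type*} [NonUnitalRing A] [Lattice A] [Module ℝ A]

instance : SetLike (LatticeSubalgebra A) A where
  coe P := P.carrier
  coe_injective P Q h := by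
    cases P
    cases Q
    congr
    exact SetLike.coe_injective h

/-- The ring operations are those of `A`. -/
instance (P : LatticeSubalgebra A) : NonUnitalRing P :=
  inferInstanceAs (NonUnitalRing P.toNonUnitalSubalgebra)

/-- The scalar multiplication is that of `A`. -/
instance (P : LatticeSubalgebra A) : Module ℝ P :=
  inferInstanceAs (Module ℝ P.toNonUnitalSubalgebra)

/-- The order is the one inherited from `A`. -/
instance (P : LatticeSubalgebra A) : Lattice P :=
  Subtype.lattice (fun _ _ ha hb => P.sup_mem' ha hb) (fun _ _ ha hb => P.inf_mem' ha hb)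

/-- The power `aᵖ` as an element of a lattice subalgebra whose underlying set is `Π_p(A)`. -/
def pow {P : LatticeSubalgebra A} {p : ℕ} (h : (P : Set A) = productSet A p) (a : A) : P :=
  ⟨finPow p a, h.symm.subset (finPow_mem_productSet p a)⟩

end LatticeSubalgebra

set_option linter.unusedSectionVars false

/-! ### Order ideals and lattice characters. -/

section Lattice

variable {A : Type*} [AddCommGroup A] [Lattice A] [IsOrderedAddMonoid A] [Module ℝ A]
  [IsOrderedModule ℝ A]

/-! Everything is reduced to inequalities between real numbers. On the order ideal generated by `e ≥
0` in an Archimedean vector lattice, the real-valued lattice homomorphisms with value 1 at `e`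
separate points (`eq_zero_of_forall_character`), so an order relation there may be tested on
characters.

The multiplicative input is `exists_isCompatible`: each character `ω` of the ideal generated by `eⁿ`
comes from a character `τ` of the ideal generated by `e`, with `ω (f₁ ⋯ fₙ) = τ f₁ ⋯ τ fₙ`. It rests
on `IsLatticeCharacter.eq_mul_of_dominated` and on the fact that multiplication by positive elements
preserves disjointness. Neither a unit nor commutativity is needed.

Uniform completeness enters through the lattice form of Stone–Weierstrass, which yields a continuous
functional calculus (`exists_forall_character_eq`). Applied to a signed `p`-th root, it writes any
element that depends continuously on finitely many factors as `φ |φ| ⋯ |φ|`. Hence `Π_p` is closed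
under sums and lattice operations, and the modulus of each of its elements is `|φ|ᵖ` for some `φ`.

For positive `f`, `g`, `u`, the condition `f ⊓ n g ≤ c u` for all `n` says at a character `τ` that
`τ g = 0` or `τ f ≤ c τ u`. This is the same condition as for the `p`-th powers with constant `cᵖ`.
Passing to powers therefore works in general. For the converse, a character of the ideal of `e` need
not come from one of the ideal of `eᵖ`; there one only learns that the `p`-th power of the excess
`(f ⊓ n g - c u)⁺` vanishes, and semiprimeness concludes. -/

theorem eq_zero_of_abs_le_zero {A : Type*} [AddCommGroup A] [Lattice A] [IsOrderedAddMonoid A]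
    {x : A} (h : |x| ≤ 0) : x = 0 :=
  le_antisymm ((le_abs_self x).trans h) (neg_nonpos.1 ((neg_le_abs x).trans h))

theorem abs_real_smul (r : ℝ) (a : A) : |r • a| = |r| • |a| := by
  have key : ∀ (s : ℝ) (b : A), 0 ≤ s → |s • b| = s • |b| := by
    intro s b hs
    rcases hs.eq_or_lt with rfl | hs
    · simp
    · apply le_antisymm
      · refine abs_le'.2 ⟨smul_le_smul_of_nonneg_left (le_abs_self b) hs.le, ?_⟩
        rw [← smul_neg]
        exact smul_le_smul_of_nonneg_left (neg_le_abs b) hs.le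
      · have h : |b| ≤ s⁻¹ • |s • b| := by
          refine abs_le'.2 ⟨?_, ?_⟩
          · calc b = s⁻¹ • (s • b) := by rw [smul_smul, inv_mul_cancel₀ hs.ne', one_smul]
              _ ≤ _ := smul_le_smul_of_nonneg_left (le_abs_self _) (inv_nonneg.2 hs.le)
          · calc -b = s⁻¹ • -(s • b) := by
                  rw [smul_neg, smul_smul, inv_mul_cancel₀ hs.ne', one_smul]
              _ ≤ _ := smul_le_smul_of_nonneg_left (neg_le_abs _) (inv_nonneg.2 hs.le)
        calc s • |b| ≤ s • (s⁻¹ • |s • b|) := smul_le_smul_of_nonneg_left h hs.le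
          _ = |s • b| := by rw [smul_smul, mul_inv_cancel₀ hs.ne', one_smul]
  rcases le_total 0 r with hr | hr
  · rw [key r a hr, abs_of_nonneg hr]
  · rw [← abs_neg, ← neg_smul, key (-r) a (neg_nonneg.2 hr), abs_of_nonpos hr]

/-- The order ideal generated by `e`. -/
def principalIdeal (e : A) : Submodule ℝ A where
  carrier := {a | ∃ c : ℝ, |a| ≤ c • e}
  zero_mem' := ⟨0, by simp⟩
  add_mem' := by
    rintro a b ⟨c, hc⟩ ⟨d, hd⟩
    exact ⟨c + d, (abs_add_le a b).trans (by rw [add_smul]; exact add_le_add hc hd)⟩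
  smul_mem' := by
    rintro r a ⟨c, hc⟩
    refine ⟨|r| * c, ?_⟩
    rw [abs_real_smul, mul_smul]
    exact smul_le_smul_of_nonneg_left hc (abs_nonneg r)

theorem mem_principalIdeal_of_abs_le {e a b : A} (h : |a| ≤ |b|) (hb : b ∈ principalIdeal e) :
    a ∈ principalIdeal e := by
  obtain ⟨c, hc⟩ := hb
  exact ⟨c, h.trans hc⟩

theorem mem_principalIdeal_of_abs_le_self {e a : A} (h : |a| ≤ e) : a ∈ principalIdeal e :=
  ⟨1, by simpa using h⟩

theorem self_mem_principalIdeal {e : A} (he : 0 ≤ e) : e ∈ principalIdeal e :=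
  mem_principalIdeal_of_abs_le_self (abs_of_nonneg he).le

theorem abs_mem_principalIdeal {e a : A} (h : a ∈ principalIdeal e) : |a| ∈ principalIdeal e :=
  mem_principalIdeal_of_abs_le (by simp) h

theorem posPart_mem_principalIdeal {e a : A} (h : a ∈ principalIdeal e) :
    a⁺ ∈ principalIdeal e :=
  mem_principalIdeal_of_abs_le
    (by rw [abs_of_nonneg (posPart_nonneg a), ← posPart_add_negPart a]
        exact le_add_of_nonneg_right (negPart_nonneg a)) h

theorem sup_mem_principalIdeal {e a b : A} (ha : a ∈ principalIdeal e)
    (hb : b ∈ principalIdeal e) : a ⊔ b ∈ principalIdeal e := by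
  rw [sup_eq_add_posPart_sub]
  exact add_mem hb (posPart_mem_principalIdeal (sub_mem ha hb))

theorem inf_mem_principalIdeal {e a b : A} (ha : a ∈ principalIdeal e)
    (hb : b ∈ principalIdeal e) : a ⊓ b ∈ principalIdeal e := by
  rw [inf_eq_sub_posPart_sub]
  exact sub_mem ha (posPart_mem_principalIdeal (sub_mem ha hb))

/-- A real-valued lattice homomorphism on the order ideal generated by `e`, normalised at `e`.
The values outside this ideal are irrelevant. -/
structure IsLatticeCharacter (e : A) (τ : A → ℝ) : Prop where
  map_add : ∀ a ∈ principalIdeal e, ∀ b ∈ principalIdeal e, τ (a + b) = τ a + τ b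
  map_smul : ∀ (r : ℝ), ∀ a ∈ principalIdeal e, τ (r • a) = r * τ a
  map_disjoint : ∀ a ∈ principalIdeal e, ∀ b ∈ principalIdeal e, a ⊓ b = 0 → τ a ⊓ τ b = 0
  map_unit : τ e = 1

namespace IsLatticeCharacter

variable {e a b : A} {τ : A → ℝ}

theorem map_zero (h : IsLatticeCharacter e τ) : τ 0 = 0 := by
  simpa using h.map_smul 0 0 (zero_mem _)

theorem map_neg (h : IsLatticeCharacter e τ) (ha : a ∈ principalIdeal e) : τ (-a) = -τ a := by
  simpa using h.map_smul (-1) a ha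

theorem map_sub (h : IsLatticeCharacter e τ) (ha : a ∈ principalIdeal e)
    (hb : b ∈ principalIdeal e) : τ (a - b) = τ a - τ b := by
  rw [sub_eq_add_neg, h.map_add a ha _ (neg_mem hb), h.map_neg hb, sub_eq_add_neg]

theorem map_nonneg (h : IsLatticeCharacter e τ) (ha : a ∈ principalIdeal e) (h0 : 0 ≤ a) :
    0 ≤ τ a := by
  have := h.map_disjoint a ha 0 (zero_mem _) (inf_eq_right.2 h0)
  rw [h.map_zero] at this
  exact inf_eq_right.1 this

theorem map_mono (h : IsLatticeCharacter e τ) (ha : a ∈ principalIdeal e)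
    (hb : b ∈ principalIdeal e) (hab : a ≤ b) : τ a ≤ τ b := by
  have := h.map_nonneg (sub_mem hb ha) (sub_nonneg.2 hab)
  rw [h.map_sub hb ha] at this
  linarith

/-- The values at `a⁺` and `a⁻` have minimum zero by disjointness, and their difference is `τ a`;
these two facts determine them. The other lattice operations follow from this one. -/
theorem map_posPart (h : IsLatticeCharacter e τ) (ha : a ∈ principalIdeal e) :
    τ a⁺ = τ a ⊔ 0 := by
  have hp := posPart_mem_principalIdeal ha
  have hn : a⁻ ∈ principalIdeal e := by
    rw [← posPart_neg]; exact posPart_mem_principalIdeal (neg_mem ha)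
  have h1 := h.map_disjoint _ hp _ hn (posPart_inf_negPart_eq_zero a)
  have h2 := h.map_sub hp hn
  rw [posPart_sub_negPart] at h2
  have h3 := h.map_nonneg hp (posPart_nonneg a)
  have h4 := h.map_nonneg hn (negPart_nonneg a)
  rcases le_total (τ a⁺) (τ a⁻) with hle | hle
  · rw [inf_eq_left.2 hle] at h1
    rw [sup_eq_right.2 (by linarith), h1]
  · rw [inf_eq_right.2 hle] at h1
    rw [sup_eq_left.2 (by linarith)]
    linarith

theorem map_sup (h : IsLatticeCharacter e τ) (ha : a ∈ principalIdeal e)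
    (hb : b ∈ principalIdeal e) : τ (a ⊔ b) = τ a ⊔ τ b := by
  have hs := sub_mem ha hb
  rw [sup_eq_add_posPart_sub, h.map_add b hb _ (posPart_mem_principalIdeal hs),
    h.map_posPart hs, h.map_sub ha hb, sup_eq_add_posPart_sub (τ a), posPart_def]

theorem map_inf (h : IsLatticeCharacter e τ) (ha : a ∈ principalIdeal e)
    (hb : b ∈ principalIdeal e) : τ (a ⊓ b) = τ a ⊓ τ b := by
  have hs := sub_mem ha hb
  rw [inf_eq_sub_posPart_sub, h.map_sub ha (posPart_mem_principalIdeal hs),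
    h.map_posPart hs, h.map_sub ha hb, inf_eq_sub_posPart_sub (τ a), posPart_def]

theorem map_abs (h : IsLatticeCharacter e τ) (ha : a ∈ principalIdeal e) : τ |a| = |τ a| := by
  rw [abs, h.map_sup ha (neg_mem ha), h.map_neg ha, abs]

end IsLatticeCharacter

/-- A linear functional dominated by a positive one that is disjoint from a lattice character `τ`
at disjoint arguments is a multiple of `τ`. -/
theorem IsLatticeCharacter.eq_mul_of_dominated {e : A} {τ lam mu : A → ℝ} (he : 0 ≤ e)
    (h : IsLatticeCharacter e τ)
    (hadd : ∀ a ∈ principalIdeal e, ∀ b ∈ principalIdeal e, lam (a + b) = lam a + lam b)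
    (hsmul : ∀ (r : ℝ), ∀ a ∈ principalIdeal e, lam (r • a) = r * lam a)
    (hdom : ∀ a ∈ principalIdeal e, |lam a| ≤ mu |a|)
    (hmu : ∀ a ∈ principalIdeal e, ∀ b ∈ principalIdeal e, mu (a + b) = mu a + mu b)
    (hmu_smul : ∀ (r : ℝ), ∀ a ∈ principalIdeal e, mu (r • a) = r * mu a)
    (hmu_mono : ∀ a ∈ principalIdeal e, ∀ b ∈ principalIdeal e, a ≤ b → mu a ≤ mu b)
    (horth : ∀ a ∈ principalIdeal e, ∀ b ∈ principalIdeal e, a ⊓ b = 0 → mu a ⊓ τ b ≤ 0)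
    {f : A} (hf : f ∈ principalIdeal e) : lam f = lam e * τ f := by
  have hee := self_mem_principalIdeal he
  have hv : f - τ f • e ∈ principalIdeal e := sub_mem hf (Submodule.smul_mem _ _ hee)
  -- The component of `f` in the kernel of `τ`; it remains to see that `lam` vanishes on it.
  have hτv : τ (f - τ f • e) = 0 := by
    rw [h.map_sub hf (Submodule.smul_mem _ _ hee), h.map_smul _ _ hee, h.map_unit]; ring
  set v := f - τ f • e with hvdef
  have hmuv : mu |v| ≤ 0 := by
    -- The negative part of `|v| - ε e` has `τ`-value `ε > 0`, so orthogonality makes `mu`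
    -- nonpositive on the disjoint positive part, and `|v|` exceeds `ε e` by at most that part.
    have key : ∀ ε : ℝ, 0 < ε → mu |v| ≤ ε * mu e := by
      intro ε hε
      have hεe : ε • e ∈ principalIdeal e := Submodule.smul_mem _ _ hee
      have hw : |v| - ε • e ∈ principalIdeal e := sub_mem (abs_mem_principalIdeal hv) hεe
      have hwp := posPart_mem_principalIdeal hw
      have hwn : (|v| - ε • e)⁻ ∈ principalIdeal e := by
        rw [← posPart_neg]; exact posPart_mem_principalIdeal (neg_mem hw)
      have h1 := horth _ hwp _ hwn (posPart_inf_negPart_eq_zero _)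
      have h2 : τ (|v| - ε • e)⁻ = ε := by
        rw [← posPart_neg, h.map_posPart (neg_mem hw), h.map_neg hw,
          h.map_sub (abs_mem_principalIdeal hv) hεe, h.map_abs hv, hτv, h.map_smul _ _ hee,
          h.map_unit]
        simp [hε.le]
      rw [h2] at h1
      have h3 : mu (|v| - ε • e)⁺ ≤ 0 := by
        rcases inf_le_iff.1 h1 with h | h
        · exact h
        · linarith
      calc mu |v| ≤ mu ((|v| - ε • e)⁺ + ε • e) :=
            hmu_mono _ (abs_mem_principalIdeal hv) _ (add_mem hwp hεe)
              (sub_le_iff_le_add.1 (le_posPart _))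
        _ = mu (|v| - ε • e)⁺ + ε * mu e := by rw [hmu _ hwp _ hεe, hmu_smul _ _ hee]
        _ ≤ ε * mu e := by linarith
    by_contra! hpos
    have h1 := key 1 one_pos
    have hmue : 0 < mu e := by linarith
    have := key (mu |v| / (2 * mu e)) (by positivity)
    have h2 : mu |v| / (2 * mu e) * mu e = mu |v| / 2 := by field_simp
    linarith
  have h0 : lam v = 0 := by
    have := (hdom v hv).trans hmuv
    exact abs_eq_zero.1 (le_antisymm this (abs_nonneg _))
  have hfv : f = v + τ f • e := by rw [hvdef]; abel
  rw [hfv, hadd v hv _ (Submodule.smul_mem _ _ hee), h0, hsmul _ _ hee, ← hfv]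
  ring

end Lattice

/-! ### Prime solid subspaces, standard parts and separation by characters. -/

section Separation

variable {A : Type*} [AddCommGroup A] [Lattice A] [IsOrderedAddMonoid A] [Module ℝ A]
  [IsOrderedModule ℝ A]

/-- A linear subspace that contains with `x` every `y` such that `|y| ≤ |x|`. -/
def Submodule.IsSolid (P : Submodule ℝ A) : Prop :=
  ∀ x ∈ P, ∀ y : A, |y| ≤ |x| → y ∈ P

namespace Submodule.IsSolid

variable {P : Submodule ℝ A}

theorem mem_of_le (hP : P.IsSolid) {x y : A} (hx : x ∈ P) (hy : 0 ≤ y) (hyx : y ≤ x) : y ∈ P :=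
  hP x hx y (by rw [abs_of_nonneg hy]; exact hyx.trans (le_abs_self x))

theorem abs_mem (hP : P.IsSolid) {x : A} (hx : x ∈ P) : |x| ∈ P := hP x hx _ (by simp)

/-- The solid subspace generated by a solid subspace `P` and a positive element `a`. -/
def adjoin (P : Submodule ℝ A) (a : A) : Submodule ℝ A where
  carrier := {x | ∃ q ∈ P, ∃ c : ℝ, |x| ≤ q + c • a}
  zero_mem' := ⟨0, zero_mem _, 0, by simp⟩
  add_mem' := by
    rintro x y ⟨q, hq, c, hc⟩ ⟨q', hq', c', hc'⟩
    refine ⟨q + q', add_mem hq hq', c + c', (abs_add_le x y).trans ?_⟩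
    rw [add_smul, add_add_add_comm]
    exact add_le_add hc hc'
  smul_mem' := by
    rintro r x ⟨q, hq, c, hc⟩
    refine ⟨|r| • q, P.smul_mem _ hq, |r| * c, ?_⟩
    rw [abs_real_smul, mul_smul, ← smul_add]
    exact smul_le_smul_of_nonneg_left hc (abs_nonneg r)

theorem isSolid_adjoin (P : Submodule ℝ A) (a : A) : (adjoin P a).IsSolid := by
  rintro x ⟨q, hq, c, hc⟩ y hy
  exact ⟨q, hq, c, hy.trans hc⟩

theorem le_adjoin (hP : P.IsSolid) (a : A) : P ≤ adjoin P a :=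
  fun x hx => ⟨|x|, hP.abs_mem hx, 0, by simp⟩

theorem mem_adjoin {a : A} (ha : 0 ≤ a) : a ∈ adjoin P a :=
  ⟨0, zero_mem _, 1, by simp [abs_of_nonneg ha]⟩

/-- An element that is contained in the solid subspaces generated by `P` and `a`, and by `P` and
`b`, with `a` and `b` disjoint, lies in `P`. -/
theorem mem_of_mem_adjoin (hP : P.IsSolid) {a b y : A} (hab : a ⊓ b = 0) (hy : 0 ≤ y)
    (hya : y ∈ adjoin P a) (hyb : y ∈ adjoin P b) : y ∈ P := by
  obtain ⟨q, hq, c, hc⟩ := hya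
  obtain ⟨r, hr, d, hd⟩ := hyb
  have ha : 0 ≤ a := hab ▸ inf_le_left
  have hb : 0 ≤ b := hab ▸ inf_le_right
  rw [abs_of_nonneg hy] at hc hd
  have hm : 0 < |c| + |d| + 1 := by positivity
  have h1 : y - (|q| + |r|) ≤ (|c| + |d| + 1) • a := by
    rw [sub_le_iff_le_add, add_comm]
    refine hc.trans (add_le_add ((le_abs_self q).trans (le_add_of_nonneg_right (abs_nonneg r))) ?_)
    exact smul_le_smul_of_nonneg_right (by linarith [le_abs_self c, abs_nonneg d]) ha
  have h2 : y - (|q| + |r|) ≤ (|c| + |d| + 1) • b := by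
    rw [sub_le_iff_le_add, add_comm]
    refine hd.trans (add_le_add ((le_abs_self r).trans (le_add_of_nonneg_left (abs_nonneg q))) ?_)
    exact smul_le_smul_of_nonneg_right (by linarith [le_abs_self d, abs_nonneg c]) hb
  have h3 : (|c| + |d| + 1)⁻¹ • (y - (|q| + |r|)) ≤ a ⊓ b := by
    apply le_inf
    · calc _ ≤ (|c| + |d| + 1)⁻¹ • ((|c| + |d| + 1) • a) :=
            smul_le_smul_of_nonneg_left h1 (inv_nonneg.2 hm.le)
        _ = a := by rw [smul_smul, inv_mul_cancel₀ hm.ne', one_smul]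
    · calc _ ≤ (|c| + |d| + 1)⁻¹ • ((|c| + |d| + 1) • b) :=
            smul_le_smul_of_nonneg_left h2 (inv_nonneg.2 hm.le)
        _ = b := by rw [smul_smul, inv_mul_cancel₀ hm.ne', one_smul]
  rw [hab] at h3
  have h4 : y - (|q| + |r|) ≤ 0 := by
    have := smul_le_smul_of_nonneg_left h3 hm.le
    rwa [smul_smul, mul_inv_cancel₀ hm.ne', one_smul, smul_zero] at this
  exact hP.mem_of_le (add_mem (hP.abs_mem hq) (hP.abs_mem hr)) hy (sub_nonpos.1 h4)

/-- For `y > 0` there is a prime solid subspace that does not contain `y`. -/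
theorem exists_prime_notMem {y : A} (hy : 0 ≤ y) (hy0 : y ≠ 0) :
    ∃ P : Submodule ℝ A, P.IsSolid ∧ y ∉ P ∧ ∀ v : A, v⁺ ∈ P ∨ v⁻ ∈ P := by
  obtain ⟨P, hmax⟩ := zorn_le₀ {P : Submodule ℝ A | P.IsSolid ∧ y ∉ P} (by
    intro c hcs hc
    rcases c.eq_empty_or_nonempty with rfl | hne
    · refine ⟨⊥, ⟨?_, by simpa using hy0⟩, by simp⟩
      intro x hx z hz
      rw [Submodule.mem_bot] at hx ⊢
      subst hx
      rw [abs_zero] at hz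
      exact eq_zero_of_abs_le_zero hz
    · refine ⟨sSup c, ⟨?_, ?_⟩, fun z hz => le_sSup hz⟩
      · intro x hx z hz
        rw [Submodule.mem_sSup_of_directed hne hc.directedOn] at hx ⊢
        obtain ⟨Q, hQ, hxQ⟩ := hx
        exact ⟨Q, hQ, (hcs hQ).1 x hxQ z hz⟩
      · rw [Submodule.mem_sSup_of_directed hne hc.directedOn]
        rintro ⟨Q, hQ, hyQ⟩
        exact (hcs hQ).2 hyQ)
  obtain ⟨⟨hP, hyP⟩, hmax⟩ := hmax
  -- Maximality: enlarging `P` by any further positive element captures `y`. If neither `v⁺` nor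
  -- `v⁻` were in `P`, then `y` would lie in both enlargements, hence in `P`, because `v⁺` and `v⁻`
  -- are disjoint.
  have ext : ∀ a : A, 0 ≤ a → a ∉ P → y ∈ adjoin P a := by
    intro a ha haP
    by_contra hya
    exact haP (hmax ⟨isSolid_adjoin P a, hya⟩ (hP.le_adjoin a) (mem_adjoin ha))
  refine ⟨P, hP, hyP, fun v => ?_⟩
  by_contra! hv
  exact hyP (hP.mem_of_mem_adjoin (posPart_inf_negPart_eq_zero v) hy
    (ext _ (posPart_nonneg v) hv.1) (ext _ (negPart_nonneg v) hv.2))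

theorem posPart_mem_of_le (hP : P.IsSolid) {v w : A} (hw : w⁺ ∈ P) (hvw : v ≤ w) : v⁺ ∈ P :=
  hP.mem_of_le hw (posPart_nonneg v) (posPart_mono hvw)

theorem posPart_add_mem (hP : P.IsSolid) {v w : A} (hv : v⁺ ∈ P) (hw : w⁺ ∈ P) :
    (v + w)⁺ ∈ P :=
  hP.mem_of_le (add_mem hv hw) (posPart_nonneg _)
    (sup_le (add_le_add (le_posPart v) (le_posPart w))
      (add_nonneg (posPart_nonneg v) (posPart_nonneg w)))

theorem posPart_smul_mem (hP : P.IsSolid) {v : A} (hv : v⁺ ∈ P) {r : ℝ} (hr : 0 ≤ r) :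
    (r • v)⁺ ∈ P :=
  hP.mem_of_le (P.smul_mem r hv) (posPart_nonneg _)
    (sup_le (smul_le_smul_of_nonneg_left (le_posPart v) hr) (smul_nonneg hr (posPart_nonneg v)))

theorem posPart_sup_mem (hP : P.IsSolid) {v w : A} (hv : v⁺ ∈ P) (hw : w⁺ ∈ P) :
    (v ⊔ w)⁺ ∈ P :=
  hP.mem_of_le (add_mem hv hw) (posPart_nonneg _)
    (sup_le (sup_le ((le_posPart v).trans (le_add_of_nonneg_right (posPart_nonneg w)))
      ((le_posPart w).trans (le_add_of_nonneg_left (posPart_nonneg v))))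
      (add_nonneg (posPart_nonneg v) (posPart_nonneg w)))

end Submodule.IsSolid

/-- The real number `r` is the standard part of `v` with respect to the unit `e`, modulo `P`. -/
def IsStandardPart (P : Submodule ℝ A) (e v : A) (r : ℝ) : Prop :=
  (∀ t < r, (t • e - v)⁺ ∈ P) ∧ ∀ t > r, (v - t • e)⁺ ∈ P

namespace IsStandardPart

variable {P : Submodule ℝ A} {e v w : A} {r s : ℝ}

theorem le (hP : P.IsSolid) (he : 0 ≤ e) (heP : e ∉ P) (hr : IsStandardPart P e v r)
    (hs : IsStandardPart P e v s) : s ≤ r := by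
  by_contra! hlt
  obtain ⟨t, hrt, hts⟩ := exists_between hlt
  obtain ⟨t', htt, hts'⟩ := exists_between hts
  have h := hP.posPart_add_mem (hs.1 t' hts') (hr.2 t hrt)
  have h1 : t' • e - v + (v - t • e) = (t' - t) • e := by rw [sub_smul]; abel
  have hpos : 0 < t' - t := sub_pos.2 htt
  rw [h1, posPart_of_nonneg (smul_nonneg hpos.le he)] at h
  exact heP ((P.smul_mem_iff hpos.ne').1 h)

theorem unique (hP : P.IsSolid) (he : 0 ≤ e) (heP : e ∉ P) (hr : IsStandardPart P e v r)
    (hs : IsStandardPart P e v s) : r = s :=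
  le_antisymm (le hP he heP hs hr) (le hP he heP hr hs)

theorem zero (he : 0 ≤ e) : IsStandardPart P e 0 0 := by
  constructor
  · intro t ht
    rw [posPart_eq_zero.2]
    · exact zero_mem _
    · simpa using smul_nonpos_of_nonpos_of_nonneg ht.le he
  · intro t ht
    rw [posPart_eq_zero.2]
    · exact zero_mem _
    · simpa using smul_nonneg (le_of_lt ht) he

theorem unit (he : 0 ≤ e) : IsStandardPart P e e 1 := by
  constructor
  · intro t ht
    rw [posPart_eq_zero.2]
    · exact zero_mem _
    · rw [sub_nonpos]
      simpa using smul_le_smul_of_nonneg_right ht.le he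
  · intro t ht
    rw [posPart_eq_zero.2]
    · exact zero_mem _
    · rw [sub_nonpos]
      simpa using smul_le_smul_of_nonneg_right (le_of_lt ht) he

theorem add (hP : P.IsSolid) (hr : IsStandardPart P e v r) (hs : IsStandardPart P e w s) :
    IsStandardPart P e (v + w) (r + s) := by
  constructor
  · intro t ht
    have h := hP.posPart_add_mem (hr.1 (r - (r + s - t) / 2) (by linarith))
      (hs.1 (s - (r + s - t) / 2) (by linarith))
    convert h using 2
    rw [show t = (r - (r + s - t) / 2) + (s - (r + s - t) / 2) by ring, add_smul]
    ring_nf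
    abel
  · intro t ht
    have h := hP.posPart_add_mem (hr.2 (r + (t - (r + s)) / 2) (by linarith))
      (hs.2 (s + (t - (r + s)) / 2) (by linarith))
    convert h using 2
    rw [show t = (r + (t - (r + s)) / 2) + (s + (t - (r + s)) / 2) by ring, add_smul]
    ring_nf
    abel

theorem neg (hr : IsStandardPart P e v r) : IsStandardPart P e (-v) (-r) := by
  constructor
  · intro t ht
    convert hr.2 (-t) (by linarith) using 2
    rw [neg_smul]; abel
  · intro t ht
    convert hr.1 (-t) (by linarith) using 2
    rw [neg_smul]; abel

theorem smul (hP : P.IsSolid) (he : 0 ≤ e) (hr : IsStandardPart P e v r) (c : ℝ) :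
    IsStandardPart P e (c • v) (c * r) := by
  have key : ∀ d : ℝ, 0 < d → IsStandardPart P e (d • v) (d * r) := by
    intro d hd
    constructor
    · intro t ht
      convert hP.posPart_smul_mem (hr.1 (t / d) (by rwa [div_lt_iff₀' hd])) hd.le using 2
      rw [smul_sub, smul_smul, mul_div_cancel₀ t hd.ne']
    · intro t ht
      convert hP.posPart_smul_mem (hr.2 (t / d) (by rwa [gt_iff_lt, lt_div_iff₀' hd])) hd.le using 2
      rw [smul_sub, smul_smul, mul_div_cancel₀ t hd.ne']
  rcases lt_trichotomy c 0 with hc | rfl | hc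
  · simpa using (key (-c) (neg_pos.2 hc)).neg
  · simpa using zero he
  · exact key c hc

theorem sup (hP : P.IsSolid) (hr : IsStandardPart P e v r) (hs : IsStandardPart P e w s) :
    IsStandardPart P e (v ⊔ w) (r ⊔ s) := by
  constructor
  · intro t ht
    rcases lt_sup_iff.1 ht with h | h
    · exact hP.posPart_mem_of_le (hr.1 t h) (sub_le_sub_left le_sup_left _)
    · exact hP.posPart_mem_of_le (hs.1 t h) (sub_le_sub_left le_sup_right _)
  · intro t ht
    obtain ⟨h1, h2⟩ := sup_lt_iff.1 ht
    convert hP.posPart_sup_mem (hr.2 t h1) (hs.2 t h2) using 2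
    rw [sub_eq_add_neg, sup_add, ← sub_eq_add_neg, ← sub_eq_add_neg]

theorem inf (hP : P.IsSolid) (hr : IsStandardPart P e v r) (hs : IsStandardPart P e w s) :
    IsStandardPart P e (v ⊓ w) (r ⊓ s) := by
  simpa [neg_sup] using (hr.neg.sup hP hs.neg).neg

/-- The standard part is the supremum of those `t` for which `t e ≤ v` modulo `P`. This set is
bounded above because `e ∉ P`; primeness, which makes the quotient order total, gives the upper half
of the cut. -/
theorem exists_of_mem (hP : P.IsSolid) (hprime : ∀ v : A, v⁺ ∈ P ∨ v⁻ ∈ P) (he : 0 ≤ e)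
    (heP : e ∉ P) (hv : v ∈ principalIdeal e) : ∃ r, IsStandardPart P e v r := by
  obtain ⟨c, hc⟩ := hv
  have hlow : -c ∈ {t : ℝ | (t • e - v)⁺ ∈ P} := by
    have : (-c) • e - v ≤ 0 := by
      rw [neg_smul, sub_nonpos]
      exact neg_le.1 ((neg_le_abs v).trans hc)
    simp only [Set.mem_ofPred_eq, posPart_eq_zero.2 this, zero_mem]
  have hup : ∀ t ∈ {t : ℝ | (t • e - v)⁺ ∈ P}, t ≤ c := by
    intro t ht
    by_contra! hlt
    have h1 : (t - c) • e ≤ t • e - v := by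
      rw [sub_smul]; exact sub_le_sub_left ((le_abs_self v).trans hc) _
    have h2 := hP.posPart_mem_of_le ht h1
    have hpos : 0 < t - c := sub_pos.2 hlt
    rw [posPart_of_nonneg (smul_nonneg hpos.le he)] at h2
    exact heP ((P.smul_mem_iff hpos.ne').1 h2)
  refine ⟨sSup {t : ℝ | (t • e - v)⁺ ∈ P}, ?_, ?_⟩
  · intro t ht
    obtain ⟨t', ht', htt⟩ := exists_lt_of_lt_csSup ⟨_, hlow⟩ ht
    exact hP.posPart_mem_of_le ht' (sub_le_sub_right (smul_le_smul_of_nonneg_right htt.le he) _)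
  · intro t ht
    rcases hprime (v - t • e) with h | h
    · exact h
    · rw [← posPart_neg, neg_sub] at h
      exact absurd (le_csSup ⟨c, hup⟩ h) (not_le.2 ht)

end IsStandardPart

/-- The lattice characters separate the points of the order ideal generated by `e`. -/
theorem eq_zero_of_forall_character (hArch : IsArchimedeanLattice A) {e x : A} (he : 0 ≤ e)
    (hx : x ∈ principalIdeal e) (h : ∀ τ, IsLatticeCharacter e τ → τ x = 0) : x = 0 := by
  by_contra hx0
  obtain ⟨n, hn⟩ : ∃ n : ℕ, ¬ n • |x| ≤ e := by
    by_contra! hall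
    exact hx0 (eq_zero_of_abs_le_zero (hArch |x| e (abs_nonneg x) he hall).le)
  have hy0 : (n • |x| - e)⁺ ≠ 0 := fun h0 => hn (sub_nonpos.1 (posPart_eq_zero.1 h0))
  obtain ⟨P, hP, hyP, hprime⟩ := Submodule.IsSolid.exists_prime_notMem (posPart_nonneg _) hy0
  -- If `e` were in `P`, the whole ideal generated by `e` would be, including `(n |x| - e)⁺`.
  have heP : e ∉ P := by
    intro heP
    obtain ⟨c, hc⟩ := hx
    have hxP : |x| ∈ P := hP.mem_of_le (P.smul_mem c heP) (abs_nonneg x) hc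
    have hd : n • |x| - e ∈ P := sub_mem (P.nsmul_mem hxP n) heP
    exact hyP (hP _ hd _ (by
      rw [abs_of_nonneg (posPart_nonneg _), ← posPart_add_negPart (n • |x| - e)]
      exact le_add_of_nonneg_right (negPart_nonneg _)))
  have hex : ∀ v : A, ∃ r : ℝ, v ∈ principalIdeal e → IsStandardPart P e v r := by
    intro v
    by_cases hv : v ∈ principalIdeal e
    · obtain ⟨r, hr⟩ := IsStandardPart.exists_of_mem hP hprime he heP hv
      exact ⟨r, fun _ => hr⟩
    · exact ⟨0, fun h => absurd h hv⟩
  choose τ hτ using hex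
  have hu : ∀ {v r}, v ∈ principalIdeal e → IsStandardPart P e v r → τ v = r :=
    fun hv hr => (hτ _ hv).unique hP he heP hr
  have hchar : IsLatticeCharacter e τ :=
    { map_add := fun a ha b hb => hu (add_mem ha hb) ((hτ a ha).add hP (hτ b hb))
      map_smul := fun r a ha => hu (Submodule.smul_mem _ r ha) ((hτ a ha).smul hP he r)
      map_disjoint := fun a ha b hb hab => by
        have h1 := (hτ a ha).inf hP (hτ b hb)
        rw [hab] at h1
        exact h1.unique hP he heP (IsStandardPart.zero he)
      map_unit := hu (self_mem_principalIdeal he) (IsStandardPart.unit he) }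
  have h0 : τ |x| = 0 := by rw [hchar.map_abs hx, h τ hchar, abs_zero]
  have hst := hτ |x| (abs_mem_principalIdeal hx)
  rw [h0] at hst
  -- Modulo `P`, the choice of `P` gives `e ≤ n |x|`, while standard part zero gives `|x| ≤ e / (n +
  -- 1)`. Together they give `e / (n + 1) ≤ 0` modulo `P`, contradicting `e ∉ P`.
  have hn1 : (e - n • |x|)⁺ ∈ P := by
    rcases hprime (n • |x| - e) with h | h
    · exact absurd h hyP
    · rwa [← posPart_neg, neg_sub] at h
  have ht : (0 : ℝ) < 1 / (n + 1) := by positivity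
  have h1 := hP.posPart_smul_mem (hst.2 _ ht) (Nat.cast_nonneg (α := ℝ) n)
  have h2 := hP.posPart_add_mem hn1 h1
  have h3 : e - n • |x| + (n : ℝ) • (|x| - (1 / ((n : ℝ) + 1)) • e) = (1 / ((n : ℝ) + 1)) • e := by
    have h4 : (1 / ((n : ℝ) + 1)) • e = e - ((n : ℝ) * (1 / ((n : ℝ) + 1))) • e := by
      nth_rewrite 2 [← one_smul ℝ e]
      rw [← sub_smul]
      congr 1
      field_simp
      ring
    rw [smul_sub, smul_smul, Nat.cast_smul_eq_nsmul]
    rw [h4]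
    abel
  rw [h3, posPart_of_nonneg (smul_nonneg ht.le he)] at h2
  exact heP ((P.smul_mem_iff ht.ne').1 h2)

theorem le_of_forall_character (hArch : IsArchimedeanLattice A) {e x y : A} (he : 0 ≤ e)
    (hx : x ∈ principalIdeal e) (hy : y ∈ principalIdeal e)
    (h : ∀ τ, IsLatticeCharacter e τ → τ x ≤ τ y) : x ≤ y := by
  have hxy := sub_mem hx hy
  have := eq_zero_of_forall_character hArch he (posPart_mem_principalIdeal hxy) fun τ hτ => by
    rw [hτ.map_posPart hxy, hτ.map_sub hx hy, sup_eq_right]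
    linarith [h τ hτ]
  exact sub_nonpos.1 (posPart_eq_zero.1 this)

end Separation

/-! ### Characters and products in an `f`-algebra. -/

section FAlgebra

variable {A : Type*} [NonUnitalRing A] [Lattice A] [IsOrderedAddMonoid A]
    [Module ℝ A] [IsOrderedModule ℝ A] [IsFAlgebra A]

namespace IsFAlgebra

theorem mul_le_mul_left {a b c : A} (h : a ≤ b) (hc : 0 ≤ c) : c * a ≤ c * b := by
  have := mul_nonneg' c (b - a) hc (sub_nonneg.2 h)
  rwa [mul_sub, sub_nonneg] at this

theorem mul_le_mul_right {a b c : A} (h : a ≤ b) (hc : 0 ≤ c) : a * c ≤ b * c := by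
  have := mul_nonneg' (b - a) c (sub_nonneg.2 h) hc
  rwa [sub_mul, sub_nonneg] at this

/-- Only positivity of the multiplication is used: `2 (|x| |y| - x y) = (|x| - x)(|y| + y) + (|x| +
x)(|y| - y)`, and similarly with the other sign. -/
theorem abs_mul_le (x y : A) : |x * y| ≤ |x| * |y| := by
  have h1 : 0 ≤ |x| - x := sub_nonneg.2 (le_abs_self x)
  have h2 : 0 ≤ |x| + x := by
    rw [← sub_neg_eq_add]; exact sub_nonneg.2 (neg_le_abs x)
  have h3 : 0 ≤ |y| - y := sub_nonneg.2 (le_abs_self y)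
  have h4 : 0 ≤ |y| + y := by
    rw [← sub_neg_eq_add]; exact sub_nonneg.2 (neg_le_abs y)
  have half : ∀ z : A, 0 ≤ z + z → 0 ≤ z := by
    intro z hz
    have := smul_nonneg (by norm_num : (0 : ℝ) ≤ 1 / 2) hz
    rwa [← two_smul ℝ z, smul_smul, show (1 / 2 : ℝ) * 2 = 1 by norm_num, one_smul] at this
  refine abs_le'.2 ⟨sub_nonneg.1 (half _ ?_), sub_nonneg.1 (half _ ?_)⟩
  · have := add_nonneg (mul_nonneg' _ _ h1 h4) (mul_nonneg' _ _ h2 h3)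
    convert this using 1
    noncomm_ring
  · have := add_nonneg (mul_nonneg' _ _ h1 h3) (mul_nonneg' _ _ h2 h4)
    convert this using 1
    noncomm_ring

theorem mul_inf_mul_eq_zero {a b c d : A} (h : a ⊓ b = 0) (hc : 0 ≤ c) (hd : 0 ≤ d) :
    (c * a) ⊓ (d * b) = 0 := by
  have h1 := mul_left_inf a b c h hc
  rw [inf_comm] at h1 ⊢
  exact mul_left_inf b _ d h1 hd

end IsFAlgebra

open IsFAlgebra

theorem finProd_add_two (n : ℕ) (f : Fin (n + 2) → A) :
    finProd (n + 2) f = finProd (n + 1) (fun i => f i.castSucc) * f (Fin.last (n + 1)) := rfl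

theorem finPow_add_two (n : ℕ) (a : A) : finPow (n + 2) a = finPow (n + 1) a * a := rfl

theorem finProd_nonneg : ∀ (n : ℕ) (f : Fin n → A), (∀ i, 0 ≤ f i) → 0 ≤ finProd n f
  | 0, _, _ => le_rfl
  | 1, _, h => h 0
  | n + 2, f, h => by
    rw [finProd_add_two]
    exact mul_nonneg' _ _ (finProd_nonneg (n + 1) _ fun i => h i.castSucc) (h _)

theorem finPow_nonneg (n : ℕ) {a : A} (ha : 0 ≤ a) : 0 ≤ finPow n a :=
  finProd_nonneg n _ fun _ => ha

theorem finPow_inf_eq_zero {a b : A} (h : a ⊓ b = 0) : ∀ n : ℕ, finPow (n + 1) a ⊓ b = 0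
  | 0 => h
  | n + 1 => by
    rw [finPow_add_two]
    exact mul_left_inf a b _ h (finPow_nonneg _ (h ▸ inf_le_left))

variable [IsScalarTower ℝ A A] [SMulCommClass ℝ A A]

theorem mul_mem_principalIdeal {d e x y : A} (hx : x ∈ principalIdeal d)
    (hy : y ∈ principalIdeal e) : x * y ∈ principalIdeal (d * e) := by
  obtain ⟨r, hr⟩ := hx
  obtain ⟨s, hs⟩ := hy
  refine ⟨r * s, (abs_mul_le x y).trans ?_⟩
  calc |x| * |y| ≤ (r • d) * |y| := mul_le_mul_right hr (abs_nonneg y)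
    _ ≤ (r • d) * (s • e) := mul_le_mul_left hs ((abs_nonneg x).trans hr)
    _ = (r * s) • (d * e) := smul_mul_smul_comm r d s e

theorem finProd_mem_principalIdeal {e : A} : ∀ (n : ℕ) (f : Fin n → A),
    (∀ i, f i ∈ principalIdeal e) → finProd n f ∈ principalIdeal (finPow n e)
  | 0, _, _ => zero_mem _
  | 1, _, h => h 0
  | n + 2, f, h => by
    rw [finProd_add_two, finPow_add_two]
    exact mul_mem_principalIdeal (finProd_mem_principalIdeal (n + 1) _ fun i => h i.castSucc) (h _)

theorem finPow_mem_principalIdeal {e a : A} (n : ℕ) (ha : a ∈ principalIdeal e) :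
    finPow n a ∈ principalIdeal (finPow n e) :=
  finProd_mem_principalIdeal n _ fun _ => ha

/-- A lattice character of the ideal generated by `d * e` splits as a product. -/
theorem IsLatticeCharacter.map_mul_eq {d e : A} (hd : 0 ≤ d) (he : 0 ≤ e) {ω : A → ℝ}
    (h : IsLatticeCharacter (d * e) ω) :
    IsLatticeCharacter d (fun x => ω (x * e)) ∧ IsLatticeCharacter e (fun x => ω (d * x)) ∧
      ∀ x ∈ principalIdeal d, ∀ y ∈ principalIdeal e, ω (x * y) = ω (x * e) * ω (d * y) := by
  have hdd := self_mem_principalIdeal hd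
  have hee := self_mem_principalIdeal he
  have h2 : IsLatticeCharacter e (fun x => ω (d * x)) :=
    { map_add := fun a ha b hb => by
        rw [mul_add, h.map_add _ (mul_mem_principalIdeal hdd ha) _ (mul_mem_principalIdeal hdd hb)]
      map_smul := fun r a ha => by
        rw [mul_smul_comm, h.map_smul _ _ (mul_mem_principalIdeal hdd ha)]
      map_disjoint := fun a ha b hb hab =>
        h.map_disjoint _ (mul_mem_principalIdeal hdd ha) _ (mul_mem_principalIdeal hdd hb)
          (mul_inf_mul_eq_zero hab hd hd)
      map_unit := h.map_unit }
  refine ⟨?_, h2, ?_⟩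
  · exact
    { map_add := fun a ha b hb => by
        rw [add_mul, h.map_add _ (mul_mem_principalIdeal ha hee) _ (mul_mem_principalIdeal hb hee)]
      map_smul := fun r a ha => by
        rw [smul_mul_assoc, h.map_smul _ _ (mul_mem_principalIdeal ha hee)]
      map_disjoint := fun a ha b hb hab =>
        h.map_disjoint _ (mul_mem_principalIdeal ha hee) _ (mul_mem_principalIdeal hb hee) (by
          have h1 := mul_right_inf a b e hab he
          rw [inf_comm] at h1 ⊢
          exact mul_right_inf b _ e h1 he)
      map_unit := h.map_unit }
  · intro x hx y hy
    have hax := abs_mem_principalIdeal hx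
    -- For fixed `x`, the functional `y ↦ ω (x y)` is dominated by `y ↦ ω (|x| y)`, which is
    -- orthogonal to `y ↦ ω (d y)` on disjoint arguments. It is thus a multiple of the latter, with
    -- factor its value `ω (x e)` at `e`.
    refine h2.eq_mul_of_dominated (lam := fun y => ω (x * y)) (mu := fun y => ω (|x| * y)) he
      ?_ ?_ ?_ ?_ ?_ ?_ ?_ hy
    · intro a ha b hb
      rw [mul_add, h.map_add _ (mul_mem_principalIdeal hx ha) _ (mul_mem_principalIdeal hx hb)]
    · intro r a ha
      rw [mul_smul_comm, h.map_smul _ _ (mul_mem_principalIdeal hx ha)]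
    · intro a ha
      have hm := mul_mem_principalIdeal hx ha
      rw [← h.map_abs hm]
      exact h.map_mono (abs_mem_principalIdeal hm)
        (mul_mem_principalIdeal hax (abs_mem_principalIdeal ha)) (abs_mul_le x a)
    · intro a ha b hb
      rw [mul_add, h.map_add _ (mul_mem_principalIdeal hax ha) _ (mul_mem_principalIdeal hax hb)]
    · intro r a ha
      rw [mul_smul_comm, h.map_smul _ _ (mul_mem_principalIdeal hax ha)]
    · intro a ha b hb hab
      exact h.map_mono (mul_mem_principalIdeal hax ha) (mul_mem_principalIdeal hax hb)
        (mul_le_mul_left hab (abs_nonneg x))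
    · intro a ha b hb hab
      exact (h.map_disjoint _ (mul_mem_principalIdeal hax ha) _ (mul_mem_principalIdeal hdd hb)
        (mul_inf_mul_eq_zero hab (abs_nonneg x) hd)).le

/-- A character `τ` of the ideal generated by `e` and a character `ω` of the ideal generated by
`eⁿ` are compatible if `ω (f₁ ⋯ fₙ) = τ f₁ ⋯ τ fₙ`. -/
structure IsCompatible (n : ℕ) (e : A) (ω τ : A → ℝ) : Prop where
  power : IsLatticeCharacter (finPow n e) ω
  base : IsLatticeCharacter e τ
  map_finProd : ∀ f : Fin n → A, (∀ i, f i ∈ principalIdeal e) →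
    ω (finProd n f) = ∏ i, τ (f i)

theorem IsCompatible.map_finPow {n : ℕ} {e : A} {ω τ : A → ℝ} (h : IsCompatible n e ω τ) {a : A}
    (ha : a ∈ principalIdeal e) : ω (finPow n a) = τ a ^ n := by
  rw [finPow, h.map_finProd _ fun _ => ha]
  simp

/-- Every character of the ideal generated by a power of `e` comes from one of the ideal
generated by `e`. -/
theorem exists_isCompatible {e : A} (he : 0 ≤ e) : ∀ (n : ℕ) (ω : A → ℝ),
    IsLatticeCharacter (finPow (n + 1) e) ω → ∃ τ, IsCompatible (n + 1) e ω τ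
  | 0, ω, h => ⟨ω, h, h, fun f _ => by simp [finProd]⟩
  | n + 1, ω, h => by
    have hpos := finPow_nonneg (n + 1) he
    have hee := self_mem_principalIdeal he
    have hpp := self_mem_principalIdeal hpos
    obtain ⟨h1, h2, h3⟩ := IsLatticeCharacter.map_mul_eq hpos he (ω := ω) h
    obtain ⟨σ, hσ⟩ := exists_isCompatible he n _ h1
    have hσeq : ∀ f ∈ principalIdeal e, σ f = ω (finPow (n + 1) e * f) := by
      intro f hf
      -- The character `σ` obtained from the left factor must agree with the one read off the right
      -- factor. Disjoint `a`, `b` give disjoint `aⁿ⁺¹ e` and `eⁿ⁺¹ b`, so `σ a ^ (n + 1)` and `ω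
      -- (eⁿ⁺¹ b)` have minimum zero; hence `σ` is a multiple of the right-hand character, and both
      -- are 1 at `e`.
      have := h2.eq_mul_of_dominated (lam := σ) (mu := σ) he hσ.base.map_add hσ.base.map_smul
        (fun a ha => (hσ.base.map_abs ha).ge) hσ.base.map_add hσ.base.map_smul
        (fun a ha b hb hab => hσ.base.map_mono ha hb hab) ?_ hf
      · rwa [hσ.base.map_unit, one_mul] at this
      · intro a ha b hb hab
        have hm1 := mul_mem_principalIdeal (finPow_mem_principalIdeal (n + 1) ha) hee
        have hm2 := mul_mem_principalIdeal hpp hb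
        have hdis : (finPow (n + 1) a * e) ⊓ (finPow (n + 1) e * b) = 0 := by
          have d1 := mul_right_inf _ _ e (finPow_inf_eq_zero hab n) he
          rw [inf_comm] at d1 ⊢
          exact mul_left_inf _ _ _ d1 hpos
        have hmin := h.map_disjoint _ hm1 _ hm2 hdis
        have hpow : ω (finPow (n + 1) a * e) = σ a ^ (n + 1) := hσ.map_finPow ha
        rw [hpow] at hmin
        rcases inf_le_iff.1 hmin.le with hle | hle
        · refine inf_le_of_left_le ?_
          by_contra! hlt
          exact absurd hle (not_le.2 (pow_pos hlt _))
        · exact inf_le_of_right_le hle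
    refine ⟨σ, h, hσ.base, fun f hf => ?_⟩
    rw [finProd_add_two, h3 _ (finProd_mem_principalIdeal (n + 1) _ fun i => hf i.castSucc) _
      (hf _), Fin.prod_univ_castSucc, hσeq _ (hf (Fin.last (n + 1)))]
    congr 1
    exact hσ.map_finProd _ fun i => hf i.castSucc

/-- Inequalities in the ideal generated by a power of `e` may be checked on compatible pairs of
characters. -/
theorem le_of_forall_isCompatible (hArch : IsArchimedeanLattice A) {e x y : A} (he : 0 ≤ e)
    {n : ℕ} (hn : 1 ≤ n) (hx : x ∈ principalIdeal (finPow n e))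
    (hy : y ∈ principalIdeal (finPow n e))
    (h : ∀ ω τ, IsCompatible n e ω τ → ω x ≤ ω y) : x ≤ y := by
  refine le_of_forall_character hArch (finPow_nonneg n he) hx hy fun ω hω => ?_
  obtain ⟨m, rfl⟩ : ∃ m, n = m + 1 := ⟨n - 1, by omega⟩
  obtain ⟨τ, hτ⟩ := exists_isCompatible he m ω hω
  exact h ω τ hτ

theorem eq_of_forall_isCompatible (hArch : IsArchimedeanLattice A) {e x y : A} (he : 0 ≤ e)
    {n : ℕ} (hn : 1 ≤ n) (hx : x ∈ principalIdeal (finPow n e))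
    (hy : y ∈ principalIdeal (finPow n e))
    (h : ∀ ω τ, IsCompatible n e ω τ → ω x = ω y) : x = y :=
  le_antisymm (le_of_forall_isCompatible hArch he hn hx hy fun ω τ hc => (h ω τ hc).le)
    (le_of_forall_isCompatible hArch he hn hy hx fun ω τ hc => (h ω τ hc).ge)

end FAlgebra

/-! ### Continuous functional calculus. -/

section FunctionalCalculus

variable {A : Type*} [AddCommGroup A] [Lattice A] [IsOrderedAddMonoid A] [Module ℝ A]
  [IsOrderedModule ℝ A]

/-- The functions of the elements `g i` that are represented by an element of the order ideal
generated by `e`. -/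
def representable {ι : Type*} (e : A) (g : ι → A) :
    Set C(Set.pi Set.univ (fun _ : ι => Set.Icc (-1 : ℝ) 1), ℝ) :=
  {F | ∃ a ∈ principalIdeal e, ∀ τ, IsLatticeCharacter e τ →
    ∀ h : (fun i => τ (g i)) ∈ Set.pi Set.univ (fun _ : ι => Set.Icc (-1 : ℝ) 1),
      τ a = F ⟨fun i => τ (g i), h⟩}

theorem character_mem_cube {ι : Type*} {e : A} (he : 0 ≤ e) {g : ι → A} (hg : ∀ i, |g i| ≤ e)
    {τ : A → ℝ} (hτ : IsLatticeCharacter e τ) :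
    (fun i => τ (g i)) ∈ Set.pi Set.univ (fun _ : ι => Set.Icc (-1 : ℝ) 1) := by
  intro i _
  have hm := mem_principalIdeal_of_abs_le_self (hg i)
  have h := hτ.map_mono (abs_mem_principalIdeal hm) (self_mem_principalIdeal he) (hg i)
  rw [hτ.map_abs hm, hτ.map_unit] at h
  exact abs_le.1 h

/-- Two distinct points of the cube differ in some coordinate `i`, and an affine function of that
coordinate takes any prescribed pair of values; it is represented by a combination of `e` and `g i`.
-/
theorem separatesPointsStrongly_representable {ι : Type*} {e : A} (he : 0 ≤ e) {g : ι → A}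
    (hg : ∀ i, |g i| ≤ e) : (representable e g).SeparatesPointsStrongly := by
  intro v x y
  have hee := self_mem_principalIdeal he
  by_cases hxy : x = y
  · subst hxy
    refine ⟨ContinuousMap.const _ (v x), ⟨v x • e, Submodule.smul_mem _ _ hee, ?_⟩, rfl, rfl⟩
    intro τ hτ h
    rw [hτ.map_smul _ _ hee, hτ.map_unit]
    simp
  · obtain ⟨i, hi⟩ : ∃ i, x.1 i ≠ y.1 i := by
      by_contra! hall
      exact hxy (Subtype.ext (funext hall))
    have hi' : y.1 i - x.1 i ≠ 0 := sub_ne_zero.2 (Ne.symm hi)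
    have hgi := mem_principalIdeal_of_abs_le_self (hg i)
    set β := (v y - v x) / (y.1 i - x.1 i) with hβ
    refine ⟨⟨fun z => (v x - β * x.1 i) + β * z.1 i, by
      have := (continuous_apply i).comp (continuous_subtype_val
        (p := (· ∈ Set.pi Set.univ (fun _ : ι => Set.Icc (-1 : ℝ) 1))))
      exact continuous_const.add (continuous_const.mul this)⟩,
      ⟨(v x - β * x.1 i) • e + β • g i, add_mem (Submodule.smul_mem _ _ hee)
        (Submodule.smul_mem _ _ hgi), ?_⟩, ?_, ?_⟩
    · intro τ hτ h
      rw [hτ.map_add _ (Submodule.smul_mem _ _ hee) _ (Submodule.smul_mem _ _ hgi),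
        hτ.map_smul _ _ hee, hτ.map_smul _ _ hgi, hτ.map_unit]
      simp
    · simp
    · simp only [ContinuousMap.coe_mk, hβ]
      field_simp
      ring

/-- Uniform convergence of functions makes their representatives `e`-uniformly Cauchy, since
characters detect the order. Uniform completeness supplies the limit, and characters are continuous
for `e`-uniform convergence. -/
theorem isClosed_representable (hArch : IsArchimedeanLattice A) (hUnif : IsUniformlyComplete A)
    {ι : Type*} {e : A} (he : 0 ≤ e) {g : ι → A} (hg : ∀ i, |g i| ≤ e) :
    IsClosed (representable e g) := by
  have : CompactSpace (Set.pi Set.univ (fun _ : ι => Set.Icc (-1 : ℝ) 1)) :=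
    isCompact_iff_compactSpace.1 (isCompact_univ_pi fun _ => isCompact_Icc)
  refine isClosed_of_closure_subset fun F hF => ?_
  have hee := self_mem_principalIdeal he
  obtain ⟨s, hs, hlim⟩ := mem_closure_iff_seq_limit.1 hF
  choose a ha hτa using hs
  have hdist : ∀ ε : ℝ, 0 < ε → ∃ N, ∀ n ≥ N, ∀ z, |s n z - F z| ≤ ε := by
    intro ε hε
    obtain ⟨N, hN⟩ := Metric.tendsto_atTop.1 hlim ε hε
    refine ⟨N, fun n hn z => ?_⟩
    rw [← Real.dist_eq]
    exact (ContinuousMap.dist_apply_le_dist z).trans (hN n hn).le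
  obtain ⟨x, hx⟩ := hUnif e he a (by
    intro ε hε
    obtain ⟨N, hN⟩ := hdist (ε / 2) (half_pos hε)
    refine ⟨N, fun m n hm hn => ?_⟩
    have hmn := sub_mem (ha m) (ha n)
    refine le_of_forall_character hArch he (abs_mem_principalIdeal hmn)
      (Submodule.smul_mem _ _ hee) fun τ hτ => ?_
    have hc := character_mem_cube he hg hτ
    rw [hτ.map_abs hmn, hτ.map_sub (ha m) (ha n), hτa m τ hτ hc, hτa n τ hτ hc,
      hτ.map_smul _ _ hee, hτ.map_unit]
    have h1 := abs_le.1 (hN m hm ⟨_, hc⟩)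
    have h2 := abs_le.1 (hN n hn ⟨_, hc⟩)
    rw [abs_le]
    constructor <;> linarith)
  have hxm : x ∈ principalIdeal e := by
    obtain ⟨N, hN⟩ := hx 1 one_pos
    have h1 : a N - x ∈ principalIdeal e := ⟨1, hN N le_rfl⟩
    simpa using sub_mem (ha N) h1
  refine ⟨x, hxm, fun τ hτ hc => ?_⟩
  refine eq_of_forall_dist_le fun ε hε => ?_
  obtain ⟨N, hN⟩ := hdist (ε / 2) (half_pos hε)
  obtain ⟨M, hM⟩ := hx (ε / 2) (half_pos hε)
  have h1 := hN (max N M) (le_max_left _ _) ⟨_, hc⟩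
  have hsub := sub_mem (ha (max N M)) hxm
  have h2 := hτ.map_mono (abs_mem_principalIdeal hsub) (Submodule.smul_mem _ _ hee)
    (hM (max N M) (le_max_right _ _))
  rw [hτ.map_abs hsub, hτ.map_sub (ha _) hxm, hτa _ τ hτ hc, hτ.map_smul _ _ hee,
    hτ.map_unit] at h2
  rw [Real.dist_eq, abs_le]
  have h1' := abs_le.1 h1
  have h2' := abs_le.1 h2
  constructor <;> linarith

/-- Continuous functional calculus in a uniformly complete Archimedean vector lattice. -/
theorem exists_forall_character_eq (hArch : IsArchimedeanLattice A)
    (hUnif : IsUniformlyComplete A) {ι : Type*} {e : A} (he : 0 ≤ e) {g : ι → A}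
    (hg : ∀ i, |g i| ≤ e) {F : (ι → ℝ) → ℝ} (hF : Continuous F) :
    ∃ a ∈ principalIdeal e, ∀ τ, IsLatticeCharacter e τ → τ a = F (fun i => τ (g i)) := by
  have : CompactSpace (Set.pi Set.univ (fun _ : ι => Set.Icc (-1 : ℝ) 1)) :=
    isCompact_iff_compactSpace.1 (isCompact_univ_pi fun _ => isCompact_Icc)
  -- Lattice form of Stone–Weierstrass: no multiplication of representatives is needed.
  have htop := ContinuousMap.sublattice_closure_eq_top (representable e g)
    ⟨0, 0, zero_mem _, fun τ hτ _ => by simp [hτ.map_zero]⟩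
    (by
      rintro f ⟨a, ha, hfa⟩ f' ⟨a', ha', hfa'⟩
      exact ⟨a ⊓ a', inf_mem_principalIdeal ha ha', fun τ hτ h => by
        rw [hτ.map_inf ha ha', hfa τ hτ h, hfa' τ hτ h, ContinuousMap.inf_apply]⟩)
    (by
      rintro f ⟨a, ha, hfa⟩ f' ⟨a', ha', hfa'⟩
      exact ⟨a ⊔ a', sup_mem_principalIdeal ha ha', fun τ hτ h => by
        rw [hτ.map_sup ha ha', hfa τ hτ h, hfa' τ hτ h, ContinuousMap.sup_apply]⟩)
    (separatesPointsStrongly_representable he hg)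
  rw [(isClosed_representable hArch hUnif he hg).closure_eq] at htop
  have hmem : (⟨fun z => F z.1, by fun_prop⟩ : C(_, ℝ)) ∈ representable e g := by
    rw [htop]; trivial
  obtain ⟨a, ha, hτa⟩ := hmem
  exact ⟨a, ha, fun τ hτ => hτa τ hτ (character_mem_cube he hg hτ)⟩

end FunctionalCalculus

/-- The odd extension of the `p`-th root to the real line. -/
noncomputable def signedRoot (p : ℕ) (r : ℝ) : ℝ :=
  (max r 0) ^ ((p : ℝ)⁻¹) - (max (-r) 0) ^ ((p : ℝ)⁻¹)

theorem continuous_signedRoot (p : ℕ) : Continuous (signedRoot p) := by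
  have h : (0 : ℝ) ≤ (p : ℝ)⁻¹ := by positivity
  exact ((continuous_id.max continuous_const).rpow_const fun _ => Or.inr h).sub
    ((continuous_neg.max continuous_const).rpow_const fun _ => Or.inr h)

/-- The form `s |s|ᵐ` keeps the sign of `s` for every `m`, whereas `sᵐ⁺¹` would lose it for even
exponents. -/
theorem signedRoot_mul_abs_pow (m : ℕ) (r : ℝ) :
    signedRoot (m + 1) r * |signedRoot (m + 1) r| ^ m = r := by
  have h0 : (((m + 1 : ℕ) : ℝ)⁻¹) ≠ 0 := by positivity
  rcases le_total 0 r with hr | hr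
  · have h : signedRoot (m + 1) r = r ^ (((m + 1 : ℕ) : ℝ)⁻¹) := by
      rw [signedRoot, max_eq_left hr, max_eq_right (neg_nonpos.2 hr), Real.zero_rpow h0, sub_zero]
    rw [h, abs_of_nonneg (Real.rpow_nonneg hr _), ← pow_succ',
      Real.rpow_inv_natCast_pow hr (Nat.succ_ne_zero m)]
  · have hr' := neg_nonneg.2 hr
    have h : signedRoot (m + 1) r = -(-r) ^ (((m + 1 : ℕ) : ℝ)⁻¹) := by
      rw [signedRoot, max_eq_right hr, max_eq_left hr', Real.zero_rpow h0, zero_sub]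
    rw [h, abs_neg, abs_of_nonneg (Real.rpow_nonneg hr' _), neg_mul, ← pow_succ',
      Real.rpow_inv_natCast_pow hr' (Nat.succ_ne_zero m), neg_neg]

/-! ### The lattice subalgebra of `p`-fold products. -/

section Products

variable {A : Type*} [NonUnitalRing A] [Lattice A] [IsOrderedAddMonoid A]
    [Module ℝ A] [IsOrderedModule ℝ A] [IsFAlgebra A] [IsScalarTower ℝ A A] [SMulCommClass ℝ A A]

theorem abs_le_sum_abs {ι : Type*} [Fintype ι] (f : ι → A) (i : ι) : |f i| ≤ ∑ j, |f j| :=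
  Finset.single_le_sum (f := fun j => |f j|) (fun j _ => abs_nonneg (f j)) (Finset.mem_univ i)

/-- At compatible characters this is multiplicativity of the real absolute value; the sum of all `|f
j|` serves as a common `e`. -/
theorem abs_finProd (hArch : IsArchimedeanLattice A) {p : ℕ} (hp : 1 ≤ p) (f : Fin p → A) :
    |finProd p f| = finProd p fun i => |f i| := by
  have he : 0 ≤ ∑ j, |f j| := Finset.sum_nonneg fun j _ => abs_nonneg (f j)
  have hf : ∀ i, f i ∈ principalIdeal (∑ j, |f j|) := fun i =>
    mem_principalIdeal_of_abs_le_self (abs_le_sum_abs f i)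
  have hfa : ∀ i, |f i| ∈ principalIdeal (∑ j, |f j|) := fun i => abs_mem_principalIdeal (hf i)
  have hm := finProd_mem_principalIdeal p f hf
  refine eq_of_forall_isCompatible hArch he hp (abs_mem_principalIdeal hm)
    (finProd_mem_principalIdeal p _ hfa) fun ω τ h => ?_
  rw [h.power.map_abs hm, h.map_finProd f hf, h.map_finProd _ hfa, Finset.abs_prod]
  exact Finset.prod_congr rfl fun i _ => (h.base.map_abs (hf i)).symm

theorem abs_finPow (hArch : IsArchimedeanLattice A) {p : ℕ} (hp : 1 ≤ p) (a : A) :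
    |finPow p a| = finPow p |a| :=
  abs_finProd hArch hp _

/-- An element that is given, on the characters, by a continuous function of the `g i` has the
form `φ |φ| ⋯ |φ|`. -/
theorem exists_eq_finProd_cons_abs (hArch : IsArchimedeanLattice A)
    (hUnif : IsUniformlyComplete A) {ι : Type*} {e : A} (he : 0 ≤ e) {g : ι → A}
    (hg : ∀ i, |g i| ≤ e) (m : ℕ) {F : (ι → ℝ) → ℝ} (hF : Continuous F) {z : A}
    (hz : z ∈ principalIdeal (finPow (m + 1) e))
    (hzF : ∀ ω τ, IsCompatible (m + 1) e ω τ → ω z = F fun i => τ (g i)) :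
    ∃ φ : A, z = finProd (m + 1) (Fin.cons φ fun _ => |φ|) := by
  -- `φ` is the signed root of `F` applied to the `g i`, so `φ |φ| ⋯ |φ|` has the same values as `z`
  -- at all compatible characters.
  obtain ⟨φ, hφ, hτφ⟩ := exists_forall_character_eq hArch hUnif he hg
    ((continuous_signedRoot (m + 1)).comp hF)
  have hc : ∀ i, (Fin.cons φ fun _ => |φ| : Fin (m + 1) → A) i ∈ principalIdeal e := by
    intro i
    refine Fin.cases ?_ (fun j => ?_) i
    · simpa using hφ
    · simpa using abs_mem_principalIdeal hφ
  refine ⟨φ, eq_of_forall_isCompatible hArch he (Nat.le_add_left 1 m) hz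
    (finProd_mem_principalIdeal _ _ hc) fun ω τ h => ?_⟩
  rw [h.map_finProd _ hc, hzF ω τ h, Fin.prod_univ_succ]
  simp only [Fin.cons_zero, Fin.cons_succ, Finset.prod_const, Finset.card_univ, Fintype.card_fin,
    h.base.map_abs hφ, hτφ τ h.base, Function.comp_apply]
  exact (signedRoot_mul_abs_pow m _).symm

theorem exists_abs_eq_finPow_abs (hArch : IsArchimedeanLattice A) (hUnif : IsUniformlyComplete A)
    {p : ℕ} (hp : 1 ≤ p) {x : A} (hx : x ∈ productSet A p) : ∃ φ : A, |x| = finPow p |φ| := by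
  obtain ⟨g, rfl⟩ := hx
  obtain ⟨m, rfl⟩ : ∃ m, p = m + 1 := ⟨p - 1, by omega⟩
  have he : 0 ≤ ∑ j, |g j| := Finset.sum_nonneg fun j _ => abs_nonneg (g j)
  have hg : ∀ i, g i ∈ principalIdeal (∑ j, |g j|) := fun i =>
    mem_principalIdeal_of_abs_le_self (abs_le_sum_abs g i)
  obtain ⟨φ, hφ⟩ := exists_eq_finProd_cons_abs hArch hUnif he (abs_le_sum_abs g) m
    (F := fun s => ∏ i, s i) (by fun_prop) (finProd_mem_principalIdeal _ g hg)
    fun ω τ h => h.map_finProd g hg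
  refine ⟨φ, ?_⟩
  rw [hφ, abs_finProd hArch hp, finPow]
  congr 1
  funext i
  refine Fin.cases ?_ (fun j => ?_) i
  · simp
  · simp

/-- The set of `p`-fold products is closed under each operation that is given, on the characters,
by a continuous function. -/
theorem mem_productSet_of_continuous (hArch : IsArchimedeanLattice A)
    (hUnif : IsUniformlyComplete A) {p : ℕ} (hp : 1 ≤ p) {op : ℝ → ℝ → ℝ}
    (hop : Continuous fun s : ℝ × ℝ => op s.1 s.2) {x y z : A} (hx : x ∈ productSet A p)
    (hy : y ∈ productSet A p)
    (hz : ∀ e : A, x ∈ principalIdeal e → y ∈ principalIdeal e → z ∈ principalIdeal e ∧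
      ∀ ω, IsLatticeCharacter e ω → ω z = op (ω x) (ω y)) : z ∈ productSet A p := by
  obtain ⟨g, rfl⟩ := hx
  obtain ⟨k, rfl⟩ := hy
  obtain ⟨m, rfl⟩ : ∃ m, p = m + 1 := ⟨p - 1, by omega⟩
  -- The factors of `x` and `y` are pooled into one family, so that both products live over a common
  -- `e`.
  set f : Fin (m + 1) ⊕ Fin (m + 1) → A := Sum.elim g k with hf
  have he : 0 ≤ ∑ j, |f j| := Finset.sum_nonneg fun j _ => abs_nonneg (f j)
  have hg : ∀ i, g i ∈ principalIdeal (∑ j, |f j|) := fun i =>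
    mem_principalIdeal_of_abs_le_self (abs_le_sum_abs f (Sum.inl i))
  have hk : ∀ i, k i ∈ principalIdeal (∑ j, |f j|) := fun i =>
    mem_principalIdeal_of_abs_le_self (abs_le_sum_abs f (Sum.inr i))
  obtain ⟨hzm, hzop⟩ := hz _ (finProd_mem_principalIdeal _ g hg)
    (finProd_mem_principalIdeal _ k hk)
  obtain ⟨φ, hφ⟩ := exists_eq_finProd_cons_abs hArch hUnif he (abs_le_sum_abs f) m
    (F := fun s => op (∏ i, s (Sum.inl i)) (∏ i, s (Sum.inr i)))
    (hop.comp (Continuous.prodMk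
      (continuous_finsetProd _ fun i _ => continuous_apply (Sum.inl i))
      (continuous_finsetProd _ fun i _ => continuous_apply (Sum.inr i)))) hzm fun ω τ h => by
      rw [hzop ω h.power, h.map_finProd g hg, h.map_finProd k hk]
      simp [hf]
  exact ⟨_, hφ⟩

/-- Absorbing `x` into the first factor keeps the number of factors; this is why `Π_p` is closed
under multiplication. -/
theorem mul_finProd (x : A) : ∀ (n : ℕ) (k : Fin (n + 1) → A),
    x * finProd (n + 1) k = finProd (n + 1) (Fin.cons (x * k 0) (Fin.tail k))
  | 0, _ => rfl
  | n + 1, k => by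
    rw [finProd_add_two, finProd_add_two, ← mul_assoc, mul_finProd x n]
    congr 2
    funext i
    refine Fin.cases ?_ (fun j => ?_) i
    · simp
    · rw [Fin.castSucc_succ, Fin.cons_succ, Fin.cons_succ]
      rfl

theorem smul_mem_productSet (r : ℝ) {p : ℕ} {x : A} (hx : x ∈ productSet A p) :
    r • x ∈ productSet A p := by
  obtain ⟨g, rfl⟩ := hx
  match p, g with
  | 0, g => exact ⟨g, smul_zero r⟩
  | 1, g => exact ⟨fun i => r • g i, rfl⟩
  | n + 2, g =>
    refine ⟨Fin.snoc (fun i => g i.castSucc) (r • g (Fin.last (n + 1))), ?_⟩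
    rw [finProd_add_two, finProd_add_two, Fin.snoc_last, mul_smul_comm]
    simp only [Fin.snoc_castSucc]

/-- The lattice subalgebra of `p`-fold products. -/
def productSubalgebra (hArch : IsArchimedeanLattice A) (hUnif : IsUniformlyComplete A)
    {p : ℕ} (hp : 1 ≤ p) : LatticeSubalgebra A where
  carrier := productSet A p
  zero_mem' := by
    simpa using smul_mem_productSet 0 (finPow_mem_productSet p (0 : A))
  add_mem' := fun {x y} hx hy =>
    mem_productSet_of_continuous hArch hUnif hp (op := fun s t => s + t) (by fun_prop) hx hy
      fun _ hxe hye => ⟨add_mem hxe hye, fun _ hω => hω.map_add x hxe y hye⟩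
  smul_mem' := fun r _ hx => smul_mem_productSet r hx
  mul_mem' := by
    rintro x y - ⟨k, rfl⟩
    obtain ⟨m, rfl⟩ : ∃ m, p = m + 1 := ⟨p - 1, by omega⟩
    exact ⟨_, mul_finProd x m k⟩
  sup_mem' := fun hx hy =>
    mem_productSet_of_continuous hArch hUnif hp (op := fun s t => s ⊔ t) (by fun_prop) hx hy
      fun _ hxe hye => ⟨sup_mem_principalIdeal hxe hye, fun _ hω => hω.map_sup hxe hye⟩
  inf_mem' := fun hx hy =>
    mem_productSet_of_continuous hArch hUnif hp (op := fun s t => s ⊓ t) (by fun_prop) hx hy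
      fun _ hxe hye => ⟨inf_mem_principalIdeal hxe hye, fun _ hω => hω.map_inf hxe hye⟩

/-! ### Majorants and powers. -/

theorem IsLatticeCharacter.map_nsmul {e a : A} {τ : A → ℝ} (h : IsLatticeCharacter e τ)
    (ha : a ∈ principalIdeal e) (n : ℕ) : τ (n • a) = n * τ a := by
  rw [← Nat.cast_smul_eq_nsmul ℝ, h.map_smul _ _ ha]

theorem finPow_inf_nsmul_finPow_le (hArch : IsArchimedeanLattice A) {p : ℕ} (hp : 1 ≤ p)
    {f g u : A} (hf : 0 ≤ f) (hg : 0 ≤ g) (hu : 0 ≤ u) {c : ℝ} (hc : 0 < c)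
    (h : ∀ n : ℕ, f ⊓ n • g ≤ c • u) (n : ℕ) :
    finPow p f ⊓ n • finPow p g ≤ c ^ p • finPow p u := by
  have he : 0 ≤ f + g + u := by positivity
  have hfe : f ∈ principalIdeal (f + g + u) := mem_principalIdeal_of_abs_le_self
    (by rw [abs_of_nonneg hf, add_assoc]; exact le_add_of_nonneg_right (add_nonneg hg hu))
  have hue : u ∈ principalIdeal (f + g + u) := mem_principalIdeal_of_abs_le_self
    (by rw [abs_of_nonneg hu]; exact le_add_of_nonneg_left (add_nonneg hf hg))
  have hge : g ∈ principalIdeal (f + g + u) := by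
    simpa using sub_mem (sub_mem (self_mem_principalIdeal he) hue) hfe
  have hfp := finPow_mem_principalIdeal p hfe
  have hgp := finPow_mem_principalIdeal p hge
  have hup := finPow_mem_principalIdeal p hue
  refine le_of_forall_isCompatible hArch he hp
    (inf_mem_principalIdeal hfp (Submodule.smul_of_tower_mem _ n hgp))
    (Submodule.smul_mem _ _ hup) fun ω τ hωτ => ?_
  rw [hωτ.power.map_inf hfp (Submodule.smul_of_tower_mem _ n hgp), hωτ.power.map_nsmul hgp,
    hωτ.power.map_smul _ _ hup]
  rw [hωτ.map_finPow hfe, hωτ.map_finPow hge, hωτ.map_finPow hue]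
  have hf0 := hωτ.base.map_nonneg hfe hf
  have hg0 := hωτ.base.map_nonneg hge hg
  have hu0 := hωτ.base.map_nonneg hue hu
  have key : ∀ k : ℕ, τ f ⊓ (k * τ g) ≤ c * τ u := by
    intro k
    have := hωτ.base.map_mono
      (inf_mem_principalIdeal hfe (Submodule.smul_of_tower_mem _ k hge))
      (Submodule.smul_mem _ c hue) (h k)
    rwa [hωτ.base.map_inf hfe (Submodule.smul_of_tower_mem _ k hge), hωτ.base.map_nsmul hge,
      hωτ.base.map_smul _ _ hue] at this
  -- If `τ g = 0` the left side is at most zero. Otherwise a large multiple of `τ g` exceeds `τ f`,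
  -- and the hypothesis becomes `τ f ≤ c τ u`, which can be raised to the power `p`.
  rcases hg0.eq_or_lt with hz | hpos
  · rw [← hz, zero_pow (by omega), mul_zero]
    exact inf_le_of_right_le (by positivity)
  · obtain ⟨k, hk⟩ := exists_nat_ge (τ f / τ g)
    have hk' : τ f ≤ k * τ g := (div_le_iff₀ hpos).1 hk
    have := key k
    rw [inf_eq_left.2 hk'] at this
    refine inf_le_of_left_le ?_
    rw [← mul_pow]
    exact pow_le_pow_left₀ hf0 this p

theorem inf_nsmul_le_of_finPow (hArch : IsArchimedeanLattice A) (hsemi : IsSemiprimeAlgebra A)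
    {p : ℕ} (hp : 1 ≤ p) {f g u : A} (hf : 0 ≤ f) (hg : 0 ≤ g) (hu : 0 ≤ u) {c : ℝ} (hc : 0 < c)
    (h : ∀ n : ℕ, finPow p f ⊓ n • finPow p g ≤ c ^ p • finPow p u) (n : ℕ) :
    f ⊓ n • g ≤ c • u := by
  have he : 0 ≤ f + g + u := by positivity
  have hfe : f ∈ principalIdeal (f + g + u) := mem_principalIdeal_of_abs_le_self
    (by rw [abs_of_nonneg hf, add_assoc]; exact le_add_of_nonneg_right (add_nonneg hg hu))
  have hue : u ∈ principalIdeal (f + g + u) := mem_principalIdeal_of_abs_le_self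
    (by rw [abs_of_nonneg hu]; exact le_add_of_nonneg_left (add_nonneg hf hg))
  have hge : g ∈ principalIdeal (f + g + u) := by
    simpa using sub_mem (sub_mem (self_mem_principalIdeal he) hue) hfe
  have hfp := finPow_mem_principalIdeal p hfe
  have hgp := finPow_mem_principalIdeal p hge
  have hup := finPow_mem_principalIdeal p hue
  have hinf := inf_mem_principalIdeal hfe (Submodule.smul_of_tower_mem _ n hge)
  have hcu : c • u ∈ principalIdeal (f + g + u) := Submodule.smul_mem _ c hue
  have hw := posPart_mem_principalIdeal (sub_mem hinf hcu)
  -- The characters available live on the ideal of `eᵖ`, so only the `p`-th power of the excess can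
  -- be tested. It vanishes there, and semiprimeness removes the power.
  refine sub_nonpos.1 (posPart_eq_zero.1 (hsemi _ ⟨p, hp, ?_⟩))
  refine eq_of_forall_isCompatible hArch he hp (finPow_mem_principalIdeal p hw)
    (zero_mem _) fun ω τ hωτ => ?_
  have hf0 := hωτ.base.map_nonneg hfe hf
  have hg0 := hωτ.base.map_nonneg hge hg
  have hu0 := hωτ.base.map_nonneg hue hu
  have key : ∀ k : ℕ, τ f ^ p ⊓ (k * τ g ^ p) ≤ c ^ p * τ u ^ p := by
    intro k
    have := hωτ.power.map_mono
      (inf_mem_principalIdeal hfp (Submodule.smul_of_tower_mem _ k hgp))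
      (Submodule.smul_mem _ (c ^ p) hup) (h k)
    rw [hωτ.power.map_inf hfp (Submodule.smul_of_tower_mem _ k hgp), hωτ.power.map_nsmul hgp,
      hωτ.power.map_smul _ _ hup] at this
    rwa [hωτ.map_finPow hfe, hωτ.map_finPow hge, hωτ.map_finPow hue] at this
  rw [hωτ.map_finPow hw, hωτ.power.map_zero, hωτ.base.map_posPart (sub_mem hinf hcu),
    hωτ.base.map_sub hinf hcu, hωτ.base.map_inf hfe (Submodule.smul_of_tower_mem _ n hge),
    hωτ.base.map_nsmul hge, hωτ.base.map_smul _ _ hue]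
  rw [sup_eq_right.2, zero_pow (by omega)]
  rw [sub_nonpos]
  rcases hg0.eq_or_lt with hz | hpos
  · rw [← hz, mul_zero]
    exact inf_le_of_right_le (by positivity)
  · obtain ⟨k, hk⟩ := exists_nat_ge (τ f ^ p / τ g ^ p)
    have hk' : τ f ^ p ≤ k * τ g ^ p := (div_le_iff₀ (pow_pos hpos p)).1 hk
    have := key k
    rw [inf_eq_left.2 hk', ← mul_pow] at this
    exact inf_le_of_left_le (le_of_pow_le_pow_left₀ (by omega) (by positivity) this)

variable {P : LatticeSubalgebra A} {p : ℕ}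

theorem LatticeSubalgebra.isMajorant_iff {φ z : P} :
    IsMajorant φ z ↔ 0 ≤ (z : A) ∧ ∀ x ∈ P, ∃ c : ℝ, 0 < c ∧
      ∀ n : ℕ, |x| ⊓ (n • |(φ : A)|) ≤ c • (z : A) :=
  ⟨fun h => ⟨h.1, fun x hx => h.2 ⟨x, hx⟩⟩, fun h => ⟨h.1, fun x => h.2 x x.2⟩⟩

/-- A test element of `Π_p` has modulus `|φ|ᵖ`, so the constant for `φ` in `A`, raised to the power
`p`, serves for it. -/
theorem IsMajorant.pow (hArch : IsArchimedeanLattice A) (hUnif : IsUniformlyComplete A)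
    (hp : 1 ≤ p) (hP : (P : Set A) = productSet A p) {g u : A} (h : IsMajorant g u) :
    IsMajorant (LatticeSubalgebra.pow hP g) (LatticeSubalgebra.pow hP u) := by
  refine LatticeSubalgebra.isMajorant_iff.2 ⟨finPow_nonneg p h.1, fun x hx => ?_⟩
  obtain ⟨φ, hφ⟩ := exists_abs_eq_finPow_abs hArch hUnif hp (hP.subset hx)
  obtain ⟨c, hc, hle⟩ := h.2 φ
  refine ⟨c ^ p, pow_pos hc p, fun n => ?_⟩
  change |x| ⊓ n • |finPow p g| ≤ c ^ p • finPow p u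
  rw [hφ, abs_finPow hArch hp]
  exact finPow_inf_nsmul_finPow_le hArch hp (abs_nonneg φ) (abs_nonneg g) h.1 hc hle n

theorem IsMajorant.of_pow (hArch : IsArchimedeanLattice A) (hsemi : IsSemiprimeAlgebra A)
    (hp : 1 ≤ p) (hP : (P : Set A) = productSet A p) {g u : A} (hu : 0 ≤ u)
    (h : IsMajorant (LatticeSubalgebra.pow hP g) (LatticeSubalgebra.pow hP u)) :
    IsMajorant g u := by
  refine ⟨hu, fun x => ?_⟩
  obtain ⟨c, hc, hle⟩ := (LatticeSubalgebra.isMajorant_iff.1 h).2 (finPow p |x|)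
    (hP.symm.subset (finPow_mem_productSet p |x|))
  -- Testing against `|x|ᵖ` in `Π_p` gives a constant for the powers; its `p`-th root is the one for
  -- `x`.
  refine ⟨c ^ ((p : ℝ)⁻¹), Real.rpow_pos_of_pos hc _, ?_⟩
  refine inf_nsmul_le_of_finPow hArch hsemi hp (abs_nonneg x) (abs_nonneg g) hu
    (Real.rpow_pos_of_pos hc _) fun n => ?_
  rw [Real.rpow_inv_natCast_pow hc.le (by omega), ← abs_finPow hArch hp g]
  have := hle n
  rwa [abs_of_nonneg (finPow_nonneg p (abs_nonneg x))] at this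

end Products

theorem theorem11 {A : Type*} [NonUnitalRing A] [Lattice A] [IsOrderedAddMonoid A]
    [Module ℝ A] [IsOrderedModule ℝ A] [IsScalarTower ℝ A A] [SMulCommClass ℝ A A]
    [IsFAlgebra A] (hArch : IsArchimedeanLattice A) (hUnif : IsUniformlyComplete A)
    (p : ℕ) (hp : 2 ≤ p) :
    ∃ (P : LatticeSubalgebra A) (hP : (P : Set A) = productSet A p),
      (∀ g u : A, IsMajorant g u →
        IsMajorant (LatticeSubalgebra.pow hP g) (LatticeSubalgebra.pow hP u)) ∧
      (IsSemiprimeAlgebra A →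
        (∀ g u : A, 0 ≤ u →
          (IsMajorant g u ↔
            IsMajorant (LatticeSubalgebra.pow hP g) (LatticeSubalgebra.pow hP u))) ∧
        (∀ g : A, IsFiniteElement g ↔ IsFiniteElement (LatticeSubalgebra.pow hP g))) := by
  have hp1 : 1 ≤ p := by omega
  have hP : ((productSubalgebra hArch hUnif hp1 : LatticeSubalgebra A) : Set A) =
    productSet A p := rfl
  refine ⟨productSubalgebra hArch hUnif hp1, hP, fun g u h => h.pow hArch hUnif hp1 hP,
    fun hsemi => ⟨fun g u hu => ⟨fun h => h.pow hArch hUnif hp1 hP,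
      fun h => h.of_pow hArch hsemi hp1 hP hu⟩, fun g => ⟨?_, ?_⟩⟩⟩
  · rintro ⟨u, hu⟩
    exact ⟨_, hu.pow hArch hUnif hp1 hP⟩
  · rintro ⟨z, hz⟩
    -- A majorant in `Π_p` need not be given as a `p`-th power, but being positive it equals `|φ|ᵖ`,
    -- and then `|φ|` is a majorant of `g`.
    obtain ⟨φ, hφ⟩ := exists_abs_eq_finPow_abs hArch hUnif hp1 (hP.subset z.2)
    have hz0 : 0 ≤ (z : A) := hz.1
    rw [abs_of_nonneg hz0] at hφ
    have hzφ : z = LatticeSubalgebra.pow hP |φ| := Subtype.ext hφ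
    rw [hzφ] at hz
    exact ⟨|φ|, hz.of_pow hArch hsemi hp1 hP (abs_nonneg φ)⟩
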